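/- Let $G=(V,E)$ be a finite digraph without loops ($E\subseteq V\times V\setminus\mathrm{diag}$; arrows $i\to j$ and $j\to i$ may both be present) and let $\mathbb K$ be a field. Let $\Lambda_p$ be the $\mathbb K$-vector space with basis all sequences $e_{i_0\dots i_p}$ of $p+1$ vertices, $\partial e_{i_0\dots i_p}=\sum_q(-1)^q e_{i_0\dots\widehat{i_q}\dots i_p}$, and let $I_p\subseteq\Lambda_p$ be spanned by the $e_{i_0\dots i_p}$ with $i_k=i_{k+1}$ for some $k$. Let $\mathcal A_p$ be spanned by the $e_{i_0\dots i_p}$ with $i_0\to i_1\to\dots\to i_p$, and let $\Omega_3(G)=\{u\in\mathcal A_3:\partial u\in\mathcal A_2 \text{ modulo } I_2\}$. For $a,b\in V$ (possibly equal) let $\Omega_3^{(a,b)}(G)$ be the space of those elements of $\Omega_3(G)$ in which only terms $e_{aijb}$ have non-zero coefficients. Write $N^+(v)=\{w: v\to w\}$, $N^-(v)=\{w: w\to v\}$, and $E(X,Y)=\{(u,v)\in E: u\in X,\ v\in Y\}$. Fix $a,b\in V$ and put $$A=N^+(a)\setminus\{b\},\quad B=N^-(b)\setminus\{a\},\quad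 P=N^+(a)\cap(N^-(b)\cup\{b\}),\quad Q=(N^+(a)\cup\{a\})\cap N^-(b).$$ Let $H$ be the digraph with vertex set $(A\setminus B)\cup(B\setminus A)$ and arrow set $E(A\setminus B,B\setminus A)$; its connected components, cycles, paths and spanning forests are those of the underlying undirected graph. Let $H_1,\dots,H_t$ be its connected components (isolated vertices included), and for each $k$ let $$S_k=E\bigl(V(H_k)\setminus B,\;Q\bigr)\cup E\bigl(P,\;V(H_k)\setminus A\bigr).$$ **Dimension.** $$\dim_{\mathbb K}\Omega_3^{(a,b)}(G)=\bigl(|E(H)|-|V(H)|+t\bigr)+|E(P,Q)|+\sum_{k=1}^t\max\{0,|S_k|-1\}.$$ **Basis.** For a sequence $\varepsilon_0,\varepsilon_1,\dots,\varepsilon_n$ of edges $\varepsilon_r=(i_r,j_r)$ call $\sum_{r=0}^n(-1)^r e_{a i_r j_r b}$ its alternating sum. Let $F$ be any spanning forest of $H$. For $e=(i,j)\in E(H)\setminus E(F)$ let $C_e$ be the cycle of $H$ that contains $e$ and has all its other edges in $F$, and let $\omega_{C_e}$ be the alternating sum of the edges of $C_e$ in cyclic order, starting at $i$ with the edge $e$.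 For each $k$ with $S_k\neq\emptyset$ choose a base edge $s_k\in S_k$; for each other $s\in S_k$ choose a path in $H_k$ from the endpoint of $s_k$ in $H_k$ to the endpoint of $s$ in $H_k$, and let $\omega^k_s$ be the alternating sum of the sequence consisting of $s_k$, the successive edges of this path, and $s$. Such choices of $F$, base edges and paths exist, and for all of them, with $$\mathcal B_0=\{\omega_{C_e}: e\in E(H)\setminus E(F)\},\quad \mathcal B_1=\{e_{aijb}:(i,j)\in E(P,Q)\},\quad \mathcal B_2=\bigcup_{k}\{\omega^k_s: s\in S_k\setminus\{s_k\}\},$$ the set $\mathcal B_0\cup\mathcal B_1\cup\mathcal B_2$ is a basis of $\Omega_3^{(a,b)}(G)$. -/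

import Mathlib

noncomputable section

namespace PathHomology

universe u v

variable {V : Type u}

/-! ### Digraphs

A digraph without loops is a `G : Digraph V` together with `∀ v, ¬ G.Adj v v`. -/

/-- The out-neighbourhood `N⁺(v)`. -/
def outNbhd (G : Digraph V) (v : V) : Set V := {w | G.Adj v w}

/-- The in-neighbourhood `N⁻(v)`. -/
def inNbhd (G : Digraph V) (v : V) : Set V := {w | G.Adj w v}

/-- `E(X, Y)`: the set of arrows of `G` that start in `X` and end in `Y`. -/
def edgesBetween (G : Digraph V) (X Y : Set V) : Set (V × V) :=
  {e | G.Adj e.1 e.2 ∧ e.1 ∈ X ∧ e.2 ∈ Y}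

/-- `Ind(X, Y)`: the digraph with vertex set `X ∪ Y` whose arrows are the arrows of `G` that start
in `X` and end in `Y`. -/
def Ind (G : Digraph V) (X Y : Set V) : Digraph ↥(X ∪ Y) where
  Adj x y := (x : V) ∈ X ∧ (y : V) ∈ Y ∧ G.Adj x y

/-- The set of all arrows of a digraph. -/
def edges (G : Digraph V) : Set (V × V) := {e | G.Adj e.1 e.2}

/-! ### Paths, boundary operator, `∂`-invariant paths -/

variable (K : Type v) [Field K]

/-- `Λ_p`: the space of formal linear combinations of elementary `p`-paths, that is, of sequences
of `p + 1` vertices. -/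
abbrev Paths (V : Type u) (p : ℕ) : Type (max u v) := (Fin (p + 1) → V) →₀ K

/-- The boundary operator `∂ : Λ_{p+1} → Λ_p`,
`∂ e_{i_0 … i_{p+1}} = ∑_q (-1)^q e_{i_0 … î_q … i_{p+1}}`. -/
def boundary (V : Type u) (p : ℕ) : Paths K V (p + 1) →ₗ[K] Paths K V p :=
  Finsupp.linearCombination K (fun x : Fin (p + 1 + 1) → V =>
    ∑ q : Fin (p + 2), (-1 : K) ^ (q : ℕ) • Finsupp.single (fun k => x (q.succAbove k)) (1 : K))

/-- `I_p`: the subspace spanned by the irregular elementary paths. The space of regular paths is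
`R_p = Λ_p / I_p`. -/
def irregularPaths (V : Type u) (p : ℕ) : Submodule K (Paths K V p) :=
  Submodule.span K ((fun x => Finsupp.single x (1 : K)) ''
    {x : Fin (p + 1) → V | ∃ k : Fin p, x k.castSucc = x k.succ})

/-- `A_p(G)`: the subspace spanned by the allowed elementary paths. -/
def allowedPaths (G : Digraph V) (p : ℕ) : Submodule K (Paths K V p) :=
  Submodule.span K ((fun x => Finsupp.single x (1 : K)) ''
    {x : Fin (p + 1) → V | ∀ k : Fin p, G.Adj (x k.castSucc) (x k.succ)})

/-- `Ω_p(G) = {u ∈ A_p | ∂u ∈ A_{p-1}}`, where the condition `∂u ∈ A_{p-1}` is read in the space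
`R_{p-1} = Λ_{p-1} / I_{p-1}` of regular paths; `Ω_0 = A_0`. -/
def Omega (G : Digraph V) : (p : ℕ) → Submodule K (Paths K V p)
  | 0 => allowedPaths K G 0
  | p + 1 => allowedPaths K G (p + 1) ⊓
      ((allowedPaths K G p).map (irregularPaths K V p).mkQ).comap
        ((irregularPaths K V p).mkQ ∘ₗ boundary K V p)

/-- The `(a, b)`-clusters: only elementary paths from `a` to `b` have non-zero coefficients. -/
def clusters (a b : V) (p : ℕ) : Submodule K (Paths K V p) :=
  Finsupp.supported K K {x : Fin (p + 1) → V | x 0 = a ∧ x (Fin.last p) = b}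

/-- `Ω_p^{(a,b)}(G)`: the space of `∂`-invariant `(a, b)`-clusters. -/
def OmegaCluster (G : Digraph V) (a b : V) (p : ℕ) : Submodule K (Paths K V p) :=
  Omega K G p ⊓ clusters K a b p

/-! ### The bipartite digraph `H` and the edge sets `S_k` -/

/-- `A = N⁺(a) \ {b}`. -/
def setA (G : Digraph V) (a b : V) : Set V := outNbhd G a \ {b}

/-- `B = N⁻(b) \ {a}`. -/
def setB (G : Digraph V) (a b : V) : Set V := inNbhd G b \ {a}

/-- The vertex set of `H`. -/
abbrev HVert (G : Digraph V) (a b : V) : Set V :=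
  (setA G a b \ setB G a b) ∪ (setB G a b \ setA G a b)

/-- `H = Ind(A \ B, B \ A)`. -/
def H (G : Digraph V) (a b : V) : Digraph (HVert G a b) :=
  Ind G (setA G a b \ setB G a b) (setB G a b \ setA G a b)

/-- `H` regarded as an undirected graph; components, cycles, paths and spanning forests of `H` are
those of this graph. -/
abbrev HUndir (G : Digraph V) (a b : V) : SimpleGraph (HVert G a b) :=
  (H G a b).toSimpleGraphInclusive

/-- The connected components of `H`. -/
abbrev HComp (G : Digraph V) (a b : V) : Type u := (HUndir G a b).ConnectedComponent

/-- `V(H_k)` as a set of vertices of `G`. -/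
def compVerts (G : Digraph V) (a b : V) (k : HComp G a b) : Set V := Subtype.val '' k.supp

/-- `N⁺(a) ∩ (N⁻(b) ∪ {b})`. -/
def freeTails (G : Digraph V) (a b : V) : Set V := outNbhd G a ∩ (inNbhd G b ∪ {b})

/-- `(N⁺(a) ∪ {a}) ∩ N⁻(b)`. -/
def freeHeads (G : Digraph V) (a b : V) : Set V := (outNbhd G a ∪ {a}) ∩ inNbhd G b

/-- `S_k`. -/
def S (G : Digraph V) (a b : V) (k : HComp G a b) : Set (V × V) :=
  edgesBetween G (compVerts G a b k \ setB G a b) (freeHeads G a b) ∪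
    edgesBetween G (freeTails G a b) (compVerts G a b k \ setA G a b)

/-! ### The basis -/

/-- The elementary `3`-path `e_{aijb}` of an edge `(i, j)`. -/
def elem (a b : V) (e : V × V) : Paths K V 3 := Finsupp.single ![a, e.1, e.2, b] 1

open Classical in
/-- The arrow of `G` underlying a step from `x` to `y` along an edge of the undirected graph `H`. -/
def stepEdge (G : Digraph V) (a b : V) (x y : HVert G a b) : V × V :=
  if (H G a b).Adj x y then (x, y) else (y, x)

/-- For a walk in `H` with successive edges `ε_0, ε_1, …, ε_{n-1}`, the alternating sum
`e_{a ε_0 b} - e_{a ε_1 b} + ⋯ + (-1)^{n-1} e_{a ε_{n-1} b}`. -/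
def altSum (G : Digraph V) (a b : V) : {x y : HVert G a b} → (HUndir G a b).Walk x y → Paths K V 3
  | _, _, .nil => 0
  | x, _, .cons (v := y) _ p => elem K a b (stepEdge G a b x y) - altSum G a b p

/-- `F` is a spanning forest of `H`. -/
structure IsSpanningForest (G : Digraph V) (a b : V) (F : SimpleGraph (HVert G a b)) : Prop where
  le : F ≤ HUndir G a b
  acyclic : F.IsAcyclic
  spanning : F.Reachable = (HUndir G a b).Reachable

/-- `B_0`: the elements `ω_{C_e}`, for `e = (i, j) ∈ E(H) \ E(F)` and `C_e` the fundamental cycle of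
`e`, that is, the cycle of `H` through `e` all of whose other edges lie in `F`. The cycle is
traversed from `i` through `e` to `j`, so that `e_{aijb}` has coefficient `1`. -/
def B₀ (G : Digraph V) (a b : V) (F : SimpleGraph (HVert G a b)) : Set (Paths K V 3) :=
  {ω | ∃ (i j : HVert G a b) (C : (HUndir G a b).Walk i i),
    (H G a b).Adj i j ∧ ¬ F.Adj i j ∧ C.IsCycle ∧ C.snd = j ∧
    (∀ ε ∈ C.edges, ε ≠ s(i, j) → ε ∈ F.edgeSet) ∧ ω = altSum K G a b C}

/-- `B_1`: the terms `e_{aijb}` with `(i, j)` an arrow from `N⁺(a) ∩ (N⁻(b) ∪ {b})` to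
`(N⁺(a) ∪ {a}) ∩ N⁻(b)`. -/
def B₁ (G : Digraph V) (a b : V) : Set (Paths K V 3) :=
  elem K a b '' edgesBetween G (freeTails G a b) (freeHeads G a b)

/-- `ω` is an element determined by the pair `s, s'` of edges in `S_k`: for some path in `H_k` from
the endpoint of `s` in `H_k` to the endpoint of `s'` in `H_k`, with successive edges
`ε_0, …, ε_{n-1}`, it is the alternating sum over the edges `s, ε_0, …, ε_{n-1}, s'`. -/
def IsPairElement (G : Digraph V) (a b : V) (k : HComp G a b) (s s' : V × V)
    (ω : Paths K V 3) : Prop :=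
  ∃ (x y : HVert G a b) (p : (HUndir G a b).Walk x y),
    x ∈ k.supp ∧ (s.1 = x ∨ s.2 = x) ∧ y ∈ k.supp ∧ (s'.1 = y ∨ s'.2 = y) ∧ p.IsPath ∧
    ω = elem K a b s - altSum K G a b p + (-1 : K) ^ (p.length + 1) • elem K a b s'

/-- The choices that enter `B_2`: for every component `H_k` with `S_k` non-empty a base edge in
`S_k`, and for every other edge `s` of `S_k` an element `ω k s` determined by the base edge
and `s`. -/
structure IsPairChoice (G : Digraph V) (a b : V) (base : HComp G a b → V × V)
    (ω : HComp G a b → V × V → Paths K V 3) : Prop where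
  base_mem : ∀ k, (S G a b k).Nonempty → base k ∈ S G a b k
  pair : ∀ k, ∀ s ∈ S G a b k, s ≠ base k → IsPairElement K G a b k (base k) s (ω k s)

/-- `B_2`. -/
def B₂ (G : Digraph V) (a b : V) (base : HComp G a b → V × V)
    (ω : HComp G a b → V × V → Paths K V 3) : Set (Paths K V 3) :=
  {η | ∃ k, ∃ s ∈ S G a b k, s ≠ base k ∧ η = ω k s}

end PathHomology

end

/-!
Fix `a` and `b`, and call an arrow `(i, j)` with `a → i → j → b` allowed. The `(a, b)`-clusters of
allowed paths have the terms `e_{aijb}` of the allowed arrows as a basis. In the boundary of such a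
cluster the only faces that may be neither allowed nor irregular are the `e_{avb}` with `v` a vertex
of `H`, and the coefficient of `e_{avb}` in `∂e_{aijb}` is the incidence number `[i = v] - [j = v]`.
So a `∂`-invariant cluster is a weighting of the allowed arrows that is conserved at every vertex of
`H` (`mem_OmegaCluster_iff`). An allowed arrow has two ends in `H` (an arrow of `H`), no end in `H`
(an arrow of `E(P, Q)`), or precisely one end in `H` (an arrow of `S_k`, for a unique `k`).

Given a spanning forest `F` and base edges, the pivots are the arrows of `H` outside `F`, the arrows
of `E(P, Q)`, and the arrows in the `S_k` other than the base edges. An invariant cluster whose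
coefficients at the pivots vanish is zero (`eq_zero_of_coeff_pivots`): summing the conservation law
over a set `W` of vertices of `H` shows that `W` cannot be left by precisely one arrow of non-zero
weight. For `W = V(H_k)` this kills the base edge of `H_k`, and for `W` one side of a tree of `F`
cut at an edge it kills that edge. So the dimension is at most the number of pivots.

Each pivot labels precisely one element of `B₀ ∪ B₁ ∪ B₂`. These elements are conserved, since
alternating sums along walks in the bipartite graph `H` telescope (`defect_altSum`), and their
matrix of coefficients at the pivots is block triangular: only the elements of `B₂` have coefficients at
pivots of another kind, namely at arrows of `H` outside `F`. So they are linearly independent, and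
being as many as the dimension allows, they form a basis (`basis_and_finrank`). The number of pivots
follows from the fact that a forest has `|V| - t` edges
(`SimpleGraph.IsAcyclic.ncard_edgeSet_add_card_connectedComponent`).
-/

/-! ### Forests and triangular families -/

open Classical in
/-- A finite forest has `|V| - t` edges, where `t` is the number of its components. -/
theorem SimpleGraph.IsAcyclic.ncard_edgeSet_add_card_connectedComponent {W : Type*} [Finite W]
    {F : SimpleGraph W} (hF : F.IsAcyclic) :
    F.edgeSet.ncard + Nat.card F.ConnectedComponent = Nat.card W := by
  have := Fintype.ofFinite W
  have := Fintype.ofFinite F.ConnectedComponent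
  let E : F.ConnectedComponent → Set (Sym2 W) := fun c =>
    Sym2.map Subtype.val '' c.toSimpleGraph.edgeSet
  have hE : F.edgeSet = ⋃ c, E c := by
    ext e
    induction e with | _ x y
    simp only [SimpleGraph.mem_edgeSet, Set.mem_iUnion, E, Set.mem_image]
    constructor
    · intro h
      refine ⟨F.connectedComponentMk x, s(⟨x, rfl⟩, ⟨y, ?_⟩), ?_, rfl⟩
      · exact SimpleGraph.ConnectedComponent.sound h.reachable.symm
      · exact h
    · rintro ⟨c, e, he, h⟩
      induction e with | _ x' y'
      have h' : F.Adj x' y' := he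
      rw [Sym2.map_mk] at h
      rwa [← SimpleGraph.mem_edgeSet, h] at h'
  have hmem : ∀ c, ∀ e ∈ E c, ∀ x ∈ e, F.connectedComponentMk x = c := by
    rintro c _ ⟨e, -, rfl⟩ x hx
    obtain ⟨z, -, rfl⟩ := Sym2.mem_map.1 hx
    exact z.2
  have hdisj : Pairwise (Function.onFun Disjoint E) := by
    intro c d hcd
    refine Set.disjoint_left.2 fun e hc hd => hcd ?_
    induction e with | _ x y
    rw [← hmem c _ hc x (Sym2.mem_mk_left x y), ← hmem d _ hd x (Sym2.mem_mk_left x y)]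
  have hcard : ∀ c, (E c).ncard + 1 = Nat.card c.supp := by
    intro c
    rw [Set.ncard_image_of_injective _ (Sym2.map.injective Subtype.val_injective)]
    exact (SimpleGraph.isTree_iff_connected_and_card.1 (hF.isTree_connectedComponent c)).2
  rw [hE, Set.ncard_iUnion_of_finite (fun c => Set.toFinite _) hdisj, finsum_eq_sum_of_fintype,
    Nat.card_eq_fintype_card (α := F.ConnectedComponent), ← Finset.card_univ,
    Finset.card_eq_sum_ones, ← Finset.sum_add_distrib, Finset.sum_congr rfl fun c _ => hcard c]
  have : W ≃ Σ c : F.ConnectedComponent, c.supp :=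
    (Equiv.sigmaFiberEquiv F.connectedComponentMk).symm
  rw [Nat.card_congr this, Nat.card_sigma]

/-- A family is linearly independent if, with respect to functionals indexed by the same set, its
matrix is block triangular with diagonal blocks that are diagonal and invertible. -/
theorem linearIndepOn_union_of_triangular {ι K M : Type*} [Field K] [AddCommGroup M] [Module K M]
    {w : ι → M} {s t : Set ι} (φ : ι → M →ₗ[K] K)
    (hs : ∀ e ∈ s, φ e (w e) ≠ 0) (hs' : ∀ e ∈ s, ∀ e' ∈ s ∪ t, e' ≠ e → φ e (w e') = 0)
    (ht : ∀ e ∈ t, φ e (w e) ≠ 0) (ht' : ∀ e ∈ t, ∀ e' ∈ t, e' ≠ e → φ e (w e') = 0) :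
    LinearIndepOn K w (s ∪ t) := by
  rw [linearIndepOn_iff]
  intro l hl h0
  have key : ∀ e, (∀ e' ∈ s ∪ t, e' ≠ e → l e' ≠ 0 → φ e (w e') = 0) → φ e (w e) ≠ 0 →
      l e = 0 := by
    intro e he hne
    have h := congrArg (φ e) h0
    rw [Finsupp.linearCombination_apply, map_finsuppSum, map_zero, Finsupp.sum,
      Finset.sum_eq_single e] at h
    · rw [map_smul, smul_eq_mul] at h
      exact (mul_eq_zero.1 h).resolve_right hne
    · intro e' he' hee'
      rw [map_smul, he e' (hl he') hee' (Finsupp.mem_support_iff.1 he'), smul_zero]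
    · intro h'
      rw [Finsupp.notMem_support_iff.1 h', zero_smul, map_zero]
  have hls : ∀ e ∈ s, l e = 0 := fun e he =>
    key e (fun e' he' hne _ => hs' e he e' he' hne) (hs e he)
  ext e
  by_cases he : e ∈ s ∪ t
  · rcases he with he | he
    · exact hls e he
    · refine key e (fun e' he' hne hle' => ?_) (ht e he)
      rcases he' with he' | he'
      · exact absurd (hls e' he') hle'
      · exact ht' e he e' he' hne
  · exact (Finsupp.mem_supported' K l).1 hl e he

noncomputable section

namespace PathHomology

universe u v

variable {V : Type u} (K : Type v) [Field K] (G : Digraph V) (a b : V)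

/-! ### Invariant clusters as conserved weights -/

/-- The arrows `(i, j)` for which `a → i → j → b`. -/
def allowedEdges : Set (V × V) := edgesBetween G (outNbhd G a) (inNbhd G b)

/-- The coefficient of `e_{aijb}`, as a linear functional. -/
def coeff (e : V × V) : Paths K V 3 →ₗ[K] K := Finsupp.lapply ![a, e.1, e.2, b]

/-- The coefficient of `e_{avb}` in the boundary, as a linear functional. -/
def defect (v : V) : Paths K V 3 →ₗ[K] K := Finsupp.lapply ![a, v, b] ∘ₗ boundary K V 2

variable {K G a b}

theorem elem_support_injective :
    Function.Injective (fun e : V × V => (![a, e.1, e.2, b] : Fin 4 → V)) := by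
  intro e e' h
  have h1 := congrFun h 1
  have h2 := congrFun h 2
  exact Prod.ext h1 h2

open Classical in
theorem coeff_elem (e e' : V × V) : coeff K a b e (elem K a b e') = if e' = e then 1 else 0 := by
  simp only [coeff, elem, Finsupp.lapply_apply, Finsupp.single_apply]
  exact if_congr elem_support_injective.eq_iff rfl rfl

theorem boundary_elem (e : V × V) : boundary K V 2 (elem K a b e) =
    Finsupp.single ![e.1, e.2, b] 1 - Finsupp.single ![a, e.2, b] 1 +
      Finsupp.single ![a, e.1, b] 1 - Finsupp.single ![a, e.1, e.2] 1 := by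
  have h0 : (fun k => (![a, e.1, e.2, b] : Fin 4 → V) (Fin.succAbove 0 k)) = ![e.1, e.2, b] := by
    ext k; fin_cases k <;> rfl
  have h1 : (fun k => (![a, e.1, e.2, b] : Fin 4 → V) (Fin.succAbove 1 k)) = ![a, e.2, b] := by
    ext k; fin_cases k <;> rfl
  have h2 : (fun k => (![a, e.1, e.2, b] : Fin 4 → V) (Fin.succAbove 2 k)) = ![a, e.1, b] := by
    ext k; fin_cases k <;> rfl
  have h3 : (fun k => (![a, e.1, e.2, b] : Fin 4 → V) (Fin.succAbove 3 k)) = ![a, e.1, e.2] := by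
    ext k; fin_cases k <;> rfl
  simp only [boundary, elem, Finsupp.linearCombination_single, one_smul]
  change ∑ q : Fin 4, _ = _
  rw [Fin.sum_univ_four]
  rw [h0, h1, h2, h3]
  simp only [Fin.val_zero, Fin.val_one, Fin.val_two, show ((3 : Fin 4) : ℕ) = 3 from rfl, pow_zero,
    pow_one, one_smul, neg_smul]
  norm_num [pow_succ]
  abel

theorem vec3_inj (x y z x' y' z' : V) (h : (![x, y, z] : Fin 3 → V) = ![x', y', z']) :
    x = x' ∧ y = y' ∧ z = z' :=
  ⟨congrFun h 0, congrFun h 1, congrFun h 2⟩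

open Classical in
/-- The defect of `e_{aijb}` at `v` is the incidence number of `v` and the arrow `(i, j)`: the faces
`e_{ijb}` and `e_{aij}` are never of the form `e_{avb}`, as `G` has no loops. -/
theorem defect_elem (hG : ∀ v, ¬ G.Adj v v) {e : V × V} (he : e ∈ allowedEdges G a b) (v : V) :
    defect K a b v (elem K a b e) = (if e.1 = v then 1 else 0) - (if e.2 = v then 1 else 0) := by
  have h0 : (![e.1, e.2, b] : Fin 3 → V) ≠ ![a, v, b] := fun h => by
    have h' := (vec3_inj _ _ _ _ _ _ h).1
    exact hG a (h' ▸ he.2.1 : a ∈ outNbhd G a)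
  have h3 : (![a, e.1, e.2] : Fin 3 → V) ≠ ![a, v, b] := fun h => by
    have h' := (vec3_inj _ _ _ _ _ _ h).2.2
    exact hG b (h' ▸ he.2.2 : b ∈ inNbhd G b)
  have h1 : ∀ w : V, (![a, w, b] : Fin 3 → V) = ![a, v, b] ↔ w = v := fun w =>
    ⟨fun h => (vec3_inj _ _ _ _ _ _ h).2.1, fun h => by rw [h]⟩
  simp only [defect, LinearMap.comp_apply, boundary_elem, Finsupp.lapply_apply, Finsupp.sub_apply,
    Finsupp.add_apply, Finsupp.single_apply, h0, h3, h1, if_false]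
  ring

theorem clusters_inf_allowedPaths :
    clusters K a b 3 ⊓ allowedPaths K G 3 =
      Submodule.span K (elem K a b '' allowedEdges G a b) := by
  have : elem K a b = (fun x => Finsupp.single x (1 : K)) ∘
      fun e : V × V => (![a, e.1, e.2, b] : Fin 4 → V) := rfl
  rw [clusters, allowedPaths, ← Finsupp.supported_eq_span_single, ← Finsupp.supported_inter,
    Finsupp.supported_eq_span_single, this, Set.image_comp]
  congr 2
  ext x
  simp only [Set.mem_inter_iff, Set.mem_ofPred_eq, Set.mem_image, Prod.exists]
  constructor
  · rintro ⟨⟨h0, h3⟩, h⟩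
    refine ⟨x 1, x 2, ⟨h 1, ?_, ?_⟩, ?_⟩
    · have := h 0
      rw [← h0]; exact this
    · have := h 2
      rw [← h3]; exact this
    · ext k; fin_cases k
      exacts [h0.symm, rfl, rfl, h3.symm]
  · rintro ⟨i, j, ⟨hij, hi, hj⟩, rfl⟩
    refine ⟨⟨rfl, rfl⟩, fun k => ?_⟩
    fin_cases k
    exacts [hi, hij, hj]

theorem mem_HVert_iff (hG : ∀ v, ¬ G.Adj v v) (v : V) : v ∈ HVert G a b ↔
    v ≠ a ∧ v ≠ b ∧ (G.Adj a v ∧ ¬ G.Adj v b ∨ ¬ G.Adj a v ∧ G.Adj v b) := by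
  change ((G.Adj a v ∧ v ≠ b) ∧ ¬ (G.Adj v b ∧ v ≠ a)) ∨
    ((G.Adj v b ∧ v ≠ a) ∧ ¬ (G.Adj a v ∧ v ≠ b)) ↔ _
  have ha : v = a → ¬ G.Adj a v := by rintro rfl; exact hG v
  have hb : v = b → ¬ G.Adj v b := by rintro rfl; exact hG v
  tauto

/-- An `(a, b)`-cluster of allowed paths is `∂`-invariant if and only if the terms `e_{avb}` of its
boundary vanish for all vertices `v` of `H`: these are the only faces that are regular but not
allowed. -/
theorem mem_OmegaCluster_iff (hG : ∀ v, ¬ G.Adj v v) (u : Paths K V 3) :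
    u ∈ OmegaCluster K G a b 3 ↔ u ∈ Submodule.span K (elem K a b '' allowedEdges G a b) ∧
      ∀ v ∈ HVert G a b, defect K a b v u = 0 := by
  have key : u ∈ OmegaCluster K G a b 3 ↔
      u ∈ Submodule.span K (elem K a b '' allowedEdges G a b) ∧
      boundary K V 2 u ∈ Finsupp.supported K K
        ({x : Fin 3 → V | ∀ k : Fin 2, G.Adj (x k.castSucc) (x k.succ)} ∪
          {x : Fin 3 → V | ∃ k : Fin 2, x k.castSucc = x k.succ}) := by
    rw [← clusters_inf_allowedPaths, Finsupp.supported_union, Finsupp.supported_eq_span_single,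
      Finsupp.supported_eq_span_single]
    change (u ∈ allowedPaths K G 3 ∧ (irregularPaths K V 2).mkQ (boundary K V 2 u) ∈
      (allowedPaths K G 2).map (irregularPaths K V 2).mkQ) ∧ u ∈ clusters K a b 3 ↔
      (u ∈ clusters K a b 3 ∧ u ∈ allowedPaths K G 3) ∧
        boundary K V 2 u ∈ allowedPaths K G 2 ⊔ irregularPaths K V 2
    rw [← Submodule.mem_comap, Submodule.comap_map_mkQ, sup_comm]
    tauto
  rw [key]
  refine and_congr_right fun hu => ?_
  rw [Finsupp.mem_supported']
  constructor
  · intro h v hv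
    obtain ⟨hva, hvb, hv⟩ := (mem_HVert_iff hG v).1 hv
    refine h _ fun hx => ?_
    rcases hx with hx | ⟨k, hk⟩
    · have h0 : G.Adj a v := hx 0
      have h1 : G.Adj v b := hx 1
      tauto
    · fin_cases k
      exacts [hva hk.symm, hvb hk]
  · intro h x hx
    by_cases hxv : ∃ v ∈ HVert G a b, ![a, v, b] = x
    · obtain ⟨v, hv, rfl⟩ := hxv
      exact h v hv
    -- Every other face that is not allowed is irregular, so it occurs in no `∂e_{aijb}`.
    suffices Submodule.span K (elem K a b '' allowedEdges G a b) ≤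
        LinearMap.ker (Finsupp.lapply (R := K) x ∘ₗ boundary K V 2) from this hu
    rw [Submodule.span_le]
    rintro _ ⟨e, ⟨he, hi : G.Adj a e.1, hj : G.Adj e.2 b⟩, rfl⟩
    rw [Set.mem_union, not_or] at hx
    obtain ⟨hx1, hx2⟩ := hx
    have h0 : ![e.1, e.2, b] ≠ x := by
      rintro rfl
      refine hx1 fun k => ?_
      fin_cases k
      exacts [he, hj]
    have h3 : ![a, e.1, e.2] ≠ x := by
      rintro rfl
      refine hx1 fun k => ?_
      fin_cases k
      exacts [hi, he]
    have hreg : ∀ v, ![a, v, b] = x → v ≠ a ∧ v ≠ b ∧ ¬ (G.Adj a v ∧ G.Adj v b) := by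
      rintro v rfl
      refine ⟨fun h => hx2 ⟨0, h.symm⟩, fun h => hx2 ⟨1, h⟩, fun h => hx1 fun k => ?_⟩
      fin_cases k
      exacts [h.1, h.2]
    have h1 : ![a, e.1, b] ≠ x := fun h => hxv ⟨e.1, by
      have := hreg _ h
      rw [mem_HVert_iff hG]
      tauto, h⟩
    have h2 : ![a, e.2, b] ≠ x := fun h => hxv ⟨e.2, by
      have := hreg _ h
      rw [mem_HVert_iff hG]
      tauto, h⟩
    simp [boundary_elem, h0, h1, h2, h3]

/-! ### Allowed arrows and their ends in `H` -/

theorem mem_allowedEdges_iff (e : V × V) :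
    e ∈ allowedEdges G a b ↔ G.Adj e.1 e.2 ∧ G.Adj a e.1 ∧ G.Adj e.2 b := Iff.rfl

theorem H_adj_iff (hG : ∀ v, ¬ G.Adj v v) (x y : HVert G a b) :
    (H G a b).Adj x y ↔ ((x : V), (y : V)) ∈ allowedEdges G a b := by
  have hx := (mem_HVert_iff hG _).1 x.2
  have hy := (mem_HVert_iff hG _).1 y.2
  rw [mem_allowedEdges_iff]
  change ((G.Adj a x ∧ (x : V) ≠ b) ∧ ¬ (G.Adj x b ∧ (x : V) ≠ a)) ∧
    ((G.Adj y b ∧ (y : V) ≠ a) ∧ ¬ (G.Adj a y ∧ (y : V) ≠ b)) ∧ G.Adj x y ↔ _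
  tauto

theorem mem_freeTails_iff (hG : ∀ v, ¬ G.Adj v v) (v : V) :
    v ∈ freeTails G a b ↔ G.Adj a v ∧ v ∉ HVert G a b := by
  rw [mem_HVert_iff hG]
  change G.Adj a v ∧ (G.Adj v b ∨ v = b) ↔ _
  have ha : v = a → ¬ G.Adj a v := by rintro rfl; exact hG v
  tauto

theorem mem_freeHeads_iff (hG : ∀ v, ¬ G.Adj v v) (v : V) :
    v ∈ freeHeads G a b ↔ G.Adj v b ∧ v ∉ HVert G a b := by
  rw [mem_HVert_iff hG]
  change (G.Adj a v ∨ v = a) ∧ G.Adj v b ↔ _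
  have hb : v = b → ¬ G.Adj v b := by rintro rfl; exact hG v
  tauto

theorem compVerts_subset (k : HComp G a b) : compVerts G a b k ⊆ HVert G a b := by
  rintro _ ⟨x, -, rfl⟩
  exact x.2

theorem eq_of_mem_compVerts {k l : HComp G a b} {v : V} (hk : v ∈ compVerts G a b k)
    (hl : v ∈ compVerts G a b l) : k = l := by
  obtain ⟨x, rfl, rfl⟩ := hk
  obtain ⟨y, rfl, hxy⟩ := hl
  rw [Subtype.ext hxy]

theorem mem_freeEdges_iff (hG : ∀ v, ¬ G.Adj v v) (e : V × V) :
    e ∈ edgesBetween G (freeTails G a b) (freeHeads G a b) ↔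
      e ∈ allowedEdges G a b ∧ e.1 ∉ HVert G a b ∧ e.2 ∉ HVert G a b := by
  change G.Adj e.1 e.2 ∧ e.1 ∈ freeTails G a b ∧ e.2 ∈ freeHeads G a b ↔ _
  rw [mem_freeTails_iff hG, mem_freeHeads_iff hG, mem_allowedEdges_iff]
  tauto

/-- `S_k` consists of the arrows `(i, j)` with `a → i → j → b` that have precisely one end in `H`,
and have it in `H_k`. -/
theorem mem_S_iff (hG : ∀ v, ¬ G.Adj v v) (k : HComp G a b) (e : V × V) :
    e ∈ S G a b k ↔ e ∈ allowedEdges G a b ∧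
      (e.1 ∈ compVerts G a b k ∧ e.2 ∉ HVert G a b ∨
        e.1 ∉ HVert G a b ∧ e.2 ∈ compVerts G a b k) := by
  change (G.Adj e.1 e.2 ∧ (e.1 ∈ compVerts G a b k ∧ ¬ (G.Adj e.1 b ∧ e.1 ≠ a)) ∧
      e.2 ∈ freeHeads G a b) ∨
    (G.Adj e.1 e.2 ∧ e.1 ∈ freeTails G a b ∧
      e.2 ∈ compVerts G a b k ∧ ¬ (G.Adj a e.2 ∧ e.2 ≠ b)) ↔ _
  rw [mem_freeTails_iff hG, mem_freeHeads_iff hG, mem_allowedEdges_iff]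
  have h1 := fun h => (mem_HVert_iff hG e.1).1 (compVerts_subset k h)
  have h2 := fun h => (mem_HVert_iff hG e.2).1 (compVerts_subset k h)
  tauto

theorem eq_of_mem_S (hG : ∀ v, ¬ G.Adj v v) {k l : HComp G a b} {e : V × V}
    (hk : e ∈ S G a b k) (hl : e ∈ S G a b l) : k = l := by
  rw [mem_S_iff hG] at hk hl
  have h1 := @compVerts_subset V G a b k e.1
  have h1' := @compVerts_subset V G a b l e.1
  rcases hk.2 with hk | hk <;> rcases hl.2 with hl | hl
  · exact eq_of_mem_compVerts hk.1 hl.1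
  · exact absurd (h1 hk.1) hl.1
  · exact absurd (h1' hl.1) hk.1
  · exact eq_of_mem_compVerts hk.2 hl.2

theorem notMem_S_of_mem_freeEdges (hG : ∀ v, ¬ G.Adj v v) {e : V × V}
    (he : e ∈ edgesBetween G (freeTails G a b) (freeHeads G a b)) (k : HComp G a b) :
    e ∉ S G a b k := by
  intro hk
  have h1 := (mem_freeEdges_iff hG _).1 he
  have h2 := (mem_S_iff hG _ _).1 hk
  have h3 := @compVerts_subset V G a b k e.1
  have h4 := @compVerts_subset V G a b k e.2
  tauto

/-- The arrows `(i, j)` with `a → i → j → b` have two, no, or precisely one end in `H`. -/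
theorem allowedEdges_cases (hG : ∀ v, ¬ G.Adj v v) {e : V × V} (he : e ∈ allowedEdges G a b) :
    (∃ x y : HVert G a b, (H G a b).Adj x y ∧ e = (↑x, ↑y)) ∨
      e ∈ edgesBetween G (freeTails G a b) (freeHeads G a b) ∨ ∃ k, e ∈ S G a b k := by
  by_cases h1 : e.1 ∈ HVert G a b <;> by_cases h2 : e.2 ∈ HVert G a b
  · exact .inl ⟨⟨_, h1⟩, ⟨_, h2⟩, (H_adj_iff hG _ _).2 he, rfl⟩
  · exact .inr (.inr ⟨_, (mem_S_iff hG _ _).2 ⟨he, .inl ⟨⟨⟨_, h1⟩, rfl, rfl⟩, h2⟩⟩⟩)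
  · exact .inr (.inr ⟨_, (mem_S_iff hG _ _).2 ⟨he, .inr ⟨h1, ⟨_, h2⟩, rfl, rfl⟩⟩⟩)
  · exact .inr (.inl ((mem_freeEdges_iff hG _).2 ⟨he, h1, h2⟩))

theorem HUndir_adj_iff (hG : ∀ v, ¬ G.Adj v v) (x y : HVert G a b) :
    (HUndir G a b).Adj x y ↔ (H G a b).Adj x y ∨ (H G a b).Adj y x := by
  change x ≠ y ∧ _ ↔ _
  refine and_iff_right_of_imp ?_
  rintro h rfl
  rw [or_self, H_adj_iff hG] at h
  exact hG _ h.1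

theorem H_asymm (hG : ∀ v, ¬ G.Adj v v) {x y : HVert G a b} (h : (H G a b).Adj x y) :
    ¬ (H G a b).Adj y x := by
  intro h'
  rw [H_adj_iff hG] at h h'
  have := (mem_HVert_iff hG _).1 x.2
  have h1 := h.2.1
  have h2 := h'.2.2
  change G.Adj a x at h1
  change G.Adj x b at h2
  tauto

/-! ### Cuts and pivots -/

section Cuts

variable [Finite V]

theorem eq_zero_of_coeff_eq_zero {u : Paths K V 3}
    (hu : u ∈ Submodule.span K (elem K a b '' allowedEdges G a b))
    (h : ∀ e ∈ allowedEdges G a b, coeff K a b e u = 0) : u = 0 := by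
  classical
  have := Fintype.ofFinite V
  have key : Set.EqOn (LinearMap.id : Paths K V 3 →ₗ[K] Paths K V 3)
      (∑ e ∈ (allowedEdges G a b).toFinset, (coeff K a b e).smulRight (elem K a b e) :
        Paths K V 3 →ₗ[K] Paths K V 3)
      (Submodule.span K (elem K a b '' allowedEdges G a b)) := by
    refine LinearMap.eqOn_span ?_
    rintro _ ⟨e, he, rfl⟩
    simp [LinearMap.sum_apply, coeff_elem, he]
  rw [show u = _ from key hu, LinearMap.sum_apply]
  refine Finset.sum_eq_zero fun e he => ?_
  rw [LinearMap.smulRight_apply, h e (Set.mem_toFinset.1 he), zero_smul]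

/-- Summing the defects over a set `W` of vertices of `H`, the arrows inside `W` cancel. So a
`∂`-invariant cluster cannot have precisely one arrow between `W` and its complement. -/
theorem coeff_eq_zero_of_cut (hG : ∀ v, ¬ G.Adj v v) {u : Paths K V 3}
    (hu : u ∈ OmegaCluster K G a b 3) {W : Set V} (hW : W ⊆ HVert G a b) {e₀ : V × V}
    (he₀ : ¬ (e₀.1 ∈ W ↔ e₀.2 ∈ W))
    (h : ∀ e ∈ allowedEdges G a b, e ≠ e₀ → coeff K a b e u ≠ 0 → (e.1 ∈ W ↔ e.2 ∈ W))
    (hmem : e₀ ∈ allowedEdges G a b) : coeff K a b e₀ u = 0 := by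
  classical
  have := Fintype.ofFinite V
  rw [mem_OmegaCluster_iff hG] at hu
  have key : Set.EqOn (∑ v ∈ W.toFinset, defect K a b v : Paths K V 3 →ₗ[K] K)
      (∑ e ∈ (allowedEdges G a b).toFinset,
        ((if e.1 ∈ W then 1 else 0) - (if e.2 ∈ W then 1 else 0) : K) • coeff K a b e :
          Paths K V 3 →ₗ[K] K)
      (Submodule.span K (elem K a b '' allowedEdges G a b)) := by
    refine LinearMap.eqOn_span ?_
    rintro _ ⟨e, he, rfl⟩
    simp [LinearMap.sum_apply, coeff_elem, defect_elem hG he, he]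
  have h0 := key hu.1
  rw [LinearMap.sum_apply, LinearMap.sum_apply,
    Finset.sum_eq_zero fun v hv => hu.2 v (hW (Set.mem_toFinset.1 hv)),
    Finset.sum_eq_single_of_mem e₀ (Set.mem_toFinset.2 hmem)] at h0
  · rw [LinearMap.smul_apply, smul_eq_mul, eq_comm, mul_eq_zero] at h0
    refine h0.resolve_left ?_
    by_cases h1 : e₀.1 ∈ W <;> by_cases h2 : e₀.2 ∈ W <;> simp [h1, h2] at he₀ ⊢
  · intro e he hne
    rw [LinearMap.smul_apply, smul_eq_mul]
    by_cases hc : coeff K a b e u = 0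
    · rw [hc, mul_zero]
    · simp [h e (Set.mem_toFinset.1 he) hne hc]

end Cuts

variable (G a b) in
/-- The arrows of `H` outside the forest `F`. -/
def chords (F : SimpleGraph (HVert G a b)) : Set (V × V) :=
  {e | ∃ x y : HVert G a b, (H G a b).Adj x y ∧ ¬ F.Adj x y ∧ e = (↑x, ↑y)}

variable (G a b) in
/-- The arrows with precisely one end in `H`, other than the base edges. -/
def nonBaseEdges (base : HComp G a b → V × V) : Set (V × V) :=
  {e | ∃ k, e ∈ S G a b k ∧ e ≠ base k}

variable (G a b) in
/-- The arrows that label the elements of the basis. -/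
def pivots (F : SimpleGraph (HVert G a b)) (base : HComp G a b → V × V) : Set (V × V) :=
  (edgesBetween G (freeTails G a b) (freeHeads G a b) ∪ nonBaseEdges G a b base) ∪ chords G a b F

/-- A `∂`-invariant cluster is determined by its coefficients at the pivots. If these vanish, the
remaining arrows are the base edges and the arrows of `F`. The base edge of `H_k` is the only one of
them that leaves `V(H_k)`, and an arrow of `F` is the only one of them that leaves one of the two
parts into which its removal splits its tree. -/
theorem eq_zero_of_coeff_pivots [Finite V] (hG : ∀ v, ¬ G.Adj v v) {F : SimpleGraph (HVert G a b)}
    (hF : IsSpanningForest G a b F) (base : HComp G a b → V × V) {u : Paths K V 3}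
    (hu : u ∈ OmegaCluster K G a b 3)
    (h : ∀ e ∈ pivots G a b F base, coeff K a b e u = 0) : u = 0 := by
  have hS : ∀ k, ∀ e ∈ S G a b k, coeff K a b e u = 0 := by
    intro k e hek
    by_cases hb : e = base k
    swap
    · exact h e (.inl (.inr ⟨k, hek, hb⟩))
    have hek' := (mem_S_iff hG k e).1 hek
    refine coeff_eq_zero_of_cut hG hu (compVerts_subset k) ?_ ?_ hek'.1
    · have h1 := @compVerts_subset V G a b k e.1
      have h2 := @compVerts_subset V G a b k e.2
      rcases hek'.2 with h' | h' <;> tauto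
    · intro e' he' hne hc
      rcases allowedEdges_cases hG he' with ⟨x, y, hxy, rfl⟩ | hfree | ⟨l, hl⟩
      · have : (HUndir G a b).connectedComponentMk x = (HUndir G a b).connectedComponentMk y :=
          SimpleGraph.ConnectedComponent.sound
            (SimpleGraph.Adj.reachable ((HUndir_adj_iff hG _ _).2 (.inl hxy)))
        constructor
        · rintro ⟨z, hz, hzx⟩
          obtain rfl := Subtype.ext hzx
          exact ⟨y, this.symm.trans hz, rfl⟩
        · rintro ⟨z, hz, hzx⟩
          obtain rfl := Subtype.ext hzx
          exact ⟨x, this.trans hz, rfl⟩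
      · exact absurd (h _ (.inl (.inl hfree))) hc
      · by_cases hl' : e' = base l
        swap
        · exact absurd (h _ (.inl (.inr ⟨l, hl, hl'⟩))) hc
        have hkl : k ≠ l := by
          rintro rfl
          exact hne (hl'.trans hb.symm)
        have hl := (mem_S_iff hG l e').1 hl
        have h1 := @compVerts_subset V G a b k e'.1
        have h2 := @compVerts_subset V G a b k e'.2
        have h1' := fun hk hl => hkl (eq_of_mem_compVerts (v := e'.1) hk hl)
        have h2' := fun hk hl => hkl (eq_of_mem_compVerts (v := e'.2) hk hl)
        rcases hl.2 with h' | h' <;> tauto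
  refine eq_zero_of_coeff_eq_zero ((mem_OmegaCluster_iff hG _).1 hu).1 fun e he => ?_
  rcases allowedEdges_cases hG he with ⟨x, y, hxy, rfl⟩ | hfree | ⟨k, hk⟩
  · by_cases hFxy : F.Adj x y
    swap
    · exact h _ (.inr ⟨x, y, hxy, hFxy, rfl⟩)
    have hbr := SimpleGraph.isAcyclic_iff_forall_adj_isBridge.1 hF.acyclic hFxy
    let F' := F.deleteEdges {s(x, y)}
    -- `W` is the side of `x` in its tree once the bridge `(x, y)` of `F` is removed.
    refine coeff_eq_zero_of_cut hG hu (W := Subtype.val '' {z | F'.Reachable x z})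
      (by rintro _ ⟨z, -, rfl⟩; exact z.2) ?_ ?_ he
    · rw [Subtype.val_injective.mem_set_image, Subtype.val_injective.mem_set_image]
      rw [SimpleGraph.isBridge_iff] at hbr
      intro hiff
      exact hbr (hiff.1 (SimpleGraph.Reachable.refl _))
    · intro e' he' hne hc
      rcases allowedEdges_cases hG he' with ⟨x', y', hxy', rfl⟩ | hfree | ⟨k, hk⟩
      · by_cases hFxy' : F.Adj x' y'
        swap
        · exact absurd (h _ (.inr ⟨x', y', hxy', hFxy', rfl⟩)) hc
        rw [Subtype.val_injective.mem_set_image, Subtype.val_injective.mem_set_image]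
        have hadj : F'.Adj x' y' := by
          refine SimpleGraph.deleteEdges_adj.2 ⟨hFxy', fun hs => ?_⟩
          rcases Sym2.eq_iff.1 hs with ⟨rfl, rfl⟩ | ⟨rfl, rfl⟩
          · exact hne rfl
          · exact H_asymm hG hxy hxy'
        exact ⟨fun hr => hr.trans hadj.reachable, fun hr => hr.trans hadj.symm.reachable⟩
      · exact absurd (h _ (.inl (.inl hfree))) hc
      · exact absurd (hS k _ hk) hc
  · exact h _ (.inl (.inl hfree))
  · exact hS k _ hk

/-! ### Alternating sums along walks -/

open Classical in
variable (K) in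
/-- The bipartition of `H` as a sign: `1` on tails of arrows of `H`, that is, on `A \ B`, and `-1`
on heads. -/
def tailSign (x : HVert G a b) : K := if G.Adj a x then 1 else -1

theorem tailSign_of_H_adj (hG : ∀ v, ¬ G.Adj v v) {x y : HVert G a b} (h : (H G a b).Adj x y) :
    tailSign K x = 1 ∧ tailSign K y = -1 := by
  rw [H_adj_iff hG] at h
  have hy := (mem_HVert_iff hG _).1 y.2
  have h1 : G.Adj a x := h.2.1
  have h2 : G.Adj y b := h.2.2
  exact ⟨if_pos h1, if_neg (by tauto)⟩

theorem stepEdge_of_H_adj {x y : HVert G a b} (h : (H G a b).Adj x y) :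
    stepEdge G a b x y = (↑x, ↑y) := by
  rw [stepEdge, if_pos h]

theorem stepEdge_of_H_adj_symm (hG : ∀ v, ¬ G.Adj v v) {x y : HVert G a b}
    (h : (H G a b).Adj y x) : stepEdge G a b x y = (↑y, ↑x) := by
  rw [stepEdge, if_neg (H_asymm hG h)]

theorem stepEdge_mem_allowedEdges (hG : ∀ v, ¬ G.Adj v v) {x y : HVert G a b}
    (h : (HUndir G a b).Adj x y) : stepEdge G a b x y ∈ allowedEdges G a b := by
  rcases (HUndir_adj_iff hG _ _).1 h with h | h
  · rw [stepEdge_of_H_adj h]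
    exact (H_adj_iff hG _ _).1 h
  · rw [stepEdge_of_H_adj_symm hG h]
    exact (H_adj_iff hG _ _).1 h

theorem tailSign_of_adj (hG : ∀ v, ¬ G.Adj v v) {x y : HVert G a b}
    (h : (HUndir G a b).Adj x y) : tailSign K y = - tailSign K x := by
  rcases (HUndir_adj_iff hG _ _).1 h with h | h
  · rw [(tailSign_of_H_adj hG h).1, (tailSign_of_H_adj hG h).2]
  · rw [(tailSign_of_H_adj hG h).1, (tailSign_of_H_adj hG h).2, neg_neg]

open Classical in
theorem defect_stepEdge (hG : ∀ v, ¬ G.Adj v v) {x y : HVert G a b}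
    (h : (HUndir G a b).Adj x y) (v : V) : defect K a b v (elem K a b (stepEdge G a b x y)) =
      tailSign K x * ((if (x : V) = v then 1 else 0) - (if (y : V) = v then 1 else 0)) := by
  rw [defect_elem hG (stepEdge_mem_allowedEdges hG h)]
  rcases (HUndir_adj_iff hG _ _).1 h with h | h
  · rw [stepEdge_of_H_adj h, (tailSign_of_H_adj hG h).1, one_mul]
  · rw [stepEdge_of_H_adj_symm hG h, (tailSign_of_H_adj hG h).2]
    ring

open Classical in
/-- The alternating signs turn consecutive arrows, which point in opposite directions along the
walk, into a telescoping sum. -/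
theorem defect_altSum (hG : ∀ v, ¬ G.Adj v v) {x y : HVert G a b} (p : (HUndir G a b).Walk x y)
    (v : V) : defect K a b v (altSum K G a b p) =
      tailSign K x * ((if (x : V) = v then 1 else 0) - (if (y : V) = v then 1 else 0)) := by
  induction p with
  | nil => simp [altSum]
  | cons h p ih =>
    rw [altSum, map_sub, ih, defect_stepEdge hG h, tailSign_of_adj hG h]
    ring

theorem tailSign_end (hG : ∀ v, ¬ G.Adj v v) {x y : HVert G a b} (p : (HUndir G a b).Walk x y) :
    tailSign K y = (-1) ^ p.length * tailSign K x := by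
  induction p with
  | nil => simp
  | cons h p ih =>
    rw [ih, tailSign_of_adj hG h, SimpleGraph.Walk.length_cons]
    ring

theorem altSum_mem_span (hG : ∀ v, ¬ G.Adj v v) {x y : HVert G a b}
    (p : (HUndir G a b).Walk x y) :
    altSum K G a b p ∈ Submodule.span K (elem K a b '' allowedEdges G a b) := by
  induction p with
  | nil => exact zero_mem _
  | cons h p ih =>
    exact sub_mem (Submodule.subset_span ⟨_, stepEdge_mem_allowedEdges hG h, rfl⟩) ih

theorem coeff_altSum_eq_zero (hG : ∀ v, ¬ G.Adj v v) {e : V × V} {x y : HVert G a b}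
    (p : (HUndir G a b).Walk x y)
    (he : ∀ i j : HVert G a b, s(i, j) ∈ p.edges → (H G a b).Adj i j → e ≠ (↑i, ↑j)) :
    coeff K a b e (altSum K G a b p) = 0 := by
  induction p with
  | nil => exact map_zero _
  | @cons i j _ h p ih =>
    rw [altSum, map_sub, ih fun i j hij => he i j (List.mem_cons_of_mem _ hij), sub_zero,
      coeff_elem, if_neg]
    rcases (HUndir_adj_iff hG _ _).1 h with h' | h'
    · rw [stepEdge_of_H_adj h']
      exact (he i j List.mem_cons_self h').symm
    · rw [stepEdge_of_H_adj_symm hG h']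
      refine (he j i ?_ h').symm
      rw [Sym2.eq_swap]
      exact List.mem_cons_self

theorem coeff_altSum_of_notMem_HVert (hG : ∀ v, ¬ G.Adj v v) {e : V × V}
    (he : ¬ (e.1 ∈ HVert G a b ∧ e.2 ∈ HVert G a b)) {x y : HVert G a b}
    (p : (HUndir G a b).Walk x y) : coeff K a b e (altSum K G a b p) = 0 := by
  refine coeff_altSum_eq_zero hG p fun i j _ _ h => he ?_
  rw [h]
  exact ⟨i.2, j.2⟩

/-! ### Cycle elements and pair elements -/

/-- `η` is an element `ω_{C_e}` for the fundamental cycle `C_e` of `e` with respect to `F`. -/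
def IsCycleElement (F : SimpleGraph (HVert G a b)) (e : V × V) (η : Paths K V 3) : Prop :=
  ∃ (i j : HVert G a b) (C : (HUndir G a b).Walk i i),
    (H G a b).Adj i j ∧ ¬ F.Adj i j ∧ C.IsCycle ∧ C.snd = j ∧
    (∀ ε ∈ C.edges, ε ≠ s(i, j) → ε ∈ F.edgeSet) ∧ e = (↑i, ↑j) ∧ η = altSum K G a b C

namespace IsCycleElement

variable {F : SimpleGraph (HVert G a b)} {e : V × V} {η : Paths K V 3}

theorem mem_chords (h : IsCycleElement F e η) : e ∈ chords G a b F := by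
  obtain ⟨i, j, C, hij, hF, -, -, -, rfl, -⟩ := h
  exact ⟨i, j, hij, hF, rfl⟩

theorem mem_OmegaCluster (hG : ∀ v, ¬ G.Adj v v) (h : IsCycleElement F e η) :
    η ∈ OmegaCluster K G a b 3 := by
  obtain ⟨i, j, C, -, -, -, -, -, -, rfl⟩ := h
  refine (mem_OmegaCluster_iff hG _).2 ⟨altSum_mem_span hG C, fun v _ => ?_⟩
  rw [defect_altSum hG, sub_self, mul_zero]

/-- The edge `e` occurs only once in `C_e`, as its first edge. -/
theorem coeff_self (hG : ∀ v, ¬ G.Adj v v) (h : IsCycleElement F e η) : coeff K a b e η = 1 := by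
  obtain ⟨i, j, C, hij, -, hC, hj, -, rfl, rfl⟩ := h
  cases C with
  | nil => exact absurd rfl hC.ne_nil
  | @cons _ j' _ hadj p =>
    obtain rfl : j' = j := by simpa using hj
    rw [altSum, map_sub, stepEdge_of_H_adj hij, coeff_elem, if_pos rfl, coeff_altSum_eq_zero hG,
      sub_zero]
    intro x y hxy hH heq
    obtain ⟨h1, h2⟩ := Prod.ext_iff.1 heq
    obtain rfl := Subtype.ext h1
    obtain rfl := Subtype.ext h2
    exact (SimpleGraph.Walk.cons_isCycle_iff p hadj).1 hC |>.2 hxy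

theorem coeff_of_ne (hG : ∀ v, ¬ G.Adj v v) (h : IsCycleElement F e η) {e' : V × V}
    (he' : e' ∈ chords G a b F) (hne : e' ≠ e) : coeff K a b e' η = 0 := by
  obtain ⟨i, j, C, hij, -, hC, hj, hF, rfl, rfl⟩ := h
  obtain ⟨x, y, hxy, hxyF, rfl⟩ := he'
  refine coeff_altSum_eq_zero hG C fun i' j' hmem hadj heq => ?_
  obtain ⟨h1, h2⟩ := Prod.ext_iff.1 heq
  obtain rfl := Subtype.ext h1
  obtain rfl := Subtype.ext h2
  refine hxyF (hF _ hmem fun hs => ?_)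
  rcases Sym2.eq_iff.1 hs with ⟨rfl, rfl⟩ | ⟨rfl, rfl⟩
  · exact hne rfl
  · exact H_asymm hG hij hxy

theorem coeff_of_notMem_HVert (hG : ∀ v, ¬ G.Adj v v) (h : IsCycleElement F e η) {e' : V × V}
    (he' : ¬ (e'.1 ∈ HVert G a b ∧ e'.2 ∈ HVert G a b)) : coeff K a b e' η = 0 := by
  obtain ⟨i, j, C, -, -, -, -, -, -, rfl⟩ := h
  exact coeff_altSum_of_notMem_HVert hG he' C

end IsCycleElement

theorem exists_isCycleElement (hG : ∀ v, ¬ G.Adj v v) {F : SimpleGraph (HVert G a b)}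
    (hF : IsSpanningForest G a b F) {e : V × V} (he : e ∈ chords G a b F) :
    ∃ η : Paths K V 3, IsCycleElement F e η := by
  classical
  obtain ⟨i, j, hij, hFij, rfl⟩ := he
  have hadj : (HUndir G a b).Adj i j := (HUndir_adj_iff hG _ _).2 (.inl hij)
  have hreach : F.Reachable j i := by
    rw [hF.spanning]
    exact hadj.symm.reachable
  obtain ⟨q, hq⟩ := hreach.exists_isPath
  have hedges : (q.mapLe hF.le).edges = q.edges := SimpleGraph.Walk.edges_mapLe_eq_edges _ _
  -- The fundamental cycle closes the path in `F` from `j` to `i` by the arrow `(i, j)`.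
  refine ⟨_, i, j, .cons hadj (q.mapLe hF.le), hij, hFij, ?_, by simp, ?_, rfl, rfl⟩
  · rw [SimpleGraph.Walk.cons_isCycle_iff, hedges]
    exact ⟨hq.mapLe hF.le, fun h => hFij (q.edges_subset_edgeSet h)⟩
  · intro ε hε hne
    rw [SimpleGraph.Walk.edges_cons, hedges] at hε
    exact q.edges_subset_edgeSet ((List.mem_cons.1 hε).resolve_left hne)

theorem elem_mem_OmegaCluster (hG : ∀ v, ¬ G.Adj v v) {e : V × V}
    (he : e ∈ edgesBetween G (freeTails G a b) (freeHeads G a b)) :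
    elem K a b e ∈ OmegaCluster K G a b 3 := by
  classical
  obtain ⟨he, h1, h2⟩ := (mem_freeEdges_iff hG e).1 he
  refine (mem_OmegaCluster_iff hG _).2 ⟨Submodule.subset_span ⟨e, he, rfl⟩, fun v hv => ?_⟩
  rw [defect_elem hG he, if_neg (fun h : e.1 = v => h1 (h ▸ hv)),
    if_neg (fun h : e.2 = v => h2 (h ▸ hv)), sub_zero]

open Classical in
/-- Only the end of an arrow of `S_k` that lies in `H` contributes a defect at a vertex of `H`. -/
theorem defect_elem_of_mem_S (hG : ∀ v, ¬ G.Adj v v) {k : HComp G a b} {s : V × V}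
    (hs : s ∈ S G a b k) {x : HVert G a b} (hx : s.1 = x ∨ s.2 = x) {v : V}
    (hv : v ∈ HVert G a b) :
    defect K a b v (elem K a b s) = tailSign K x * (if (x : V) = v then 1 else 0) := by
  obtain ⟨hs, hS⟩ := (mem_S_iff hG k s).1 hs
  rw [defect_elem hG hs]
  have hxH := (mem_HVert_iff hG _).1 x.2
  rcases hS with ⟨h1, h2⟩ | ⟨h1, h2⟩
  · have hx1 : s.1 = x := hx.resolve_right fun h => h2 (h ▸ x.2)
    have : tailSign K x = 1 := if_pos (hx1 ▸ hs.2.1)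
    rw [if_neg (fun h : s.2 = v => h2 (h ▸ hv)), hx1, this]
    ring
  · have hx1 : s.2 = x := hx.resolve_left fun h => h1 (h ▸ x.2)
    have hb : G.Adj x b := hx1 ▸ hs.2.2
    have : tailSign K x = -1 := if_neg (by tauto)
    rw [if_neg (fun h : s.1 = v => h1 (h ▸ hv)), hx1, this]
    ring

theorem notMem_HVert_of_mem_S (hG : ∀ v, ¬ G.Adj v v) {k : HComp G a b} {s : V × V}
    (hs : s ∈ S G a b k) : ¬ (s.1 ∈ HVert G a b ∧ s.2 ∈ HVert G a b) := by
  have := ((mem_S_iff hG k s).1 hs).2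
  tauto

namespace IsPairElement

variable {k : HComp G a b} {s s' : V × V} {η : Paths K V 3}

theorem mem_OmegaCluster (hG : ∀ v, ¬ G.Adj v v) (h : IsPairElement K G a b k s s' η)
    (hs : s ∈ S G a b k) (hs' : s' ∈ S G a b k) : η ∈ OmegaCluster K G a b 3 := by
  classical
  obtain ⟨x, y, p, -, hx, -, hy, -, rfl⟩ := h
  refine (mem_OmegaCluster_iff hG _).2 ⟨?_, fun v hv => ?_⟩
  · refine add_mem (sub_mem ?_ (altSum_mem_span hG p)) (Submodule.smul_mem _ _ ?_)
    · exact Submodule.subset_span ⟨s, ((mem_S_iff hG k s).1 hs).1, rfl⟩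
    · exact Submodule.subset_span ⟨s', ((mem_S_iff hG k s').1 hs').1, rfl⟩
  · rw [map_add, map_sub, map_smul, defect_altSum hG, defect_elem_of_mem_S hG hs hx hv,
      defect_elem_of_mem_S hG hs' hy hv, tailSign_end hG p, smul_eq_mul, pow_succ]
    have : ((-1 : K) ^ p.length) * (-1) ^ p.length = 1 := by
      rw [← mul_pow]
      simp
    linear_combination (- tailSign K x * (if (y : V) = v then 1 else 0)) * this

theorem coeff_self (hG : ∀ v, ¬ G.Adj v v) (h : IsPairElement K G a b k s s' η)
    (hs' : s' ∈ S G a b k) (hne : s' ≠ s) : coeff K a b s' η ≠ 0 := by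
  obtain ⟨x, y, p, -, -, -, -, -, rfl⟩ := h
  rw [map_add, map_sub, map_smul, coeff_elem, coeff_elem, if_neg hne.symm, if_pos rfl,
    coeff_altSum_of_notMem_HVert hG (notMem_HVert_of_mem_S hG hs')]
  simp

theorem coeff_of_ne (hG : ∀ v, ¬ G.Adj v v) (h : IsPairElement K G a b k s s' η) {e : V × V}
    (he : ¬ (e.1 ∈ HVert G a b ∧ e.2 ∈ HVert G a b)) (hs : e ≠ s) (hs' : e ≠ s') :
    coeff K a b e η = 0 := by
  obtain ⟨x, y, p, -, -, -, -, -, rfl⟩ := h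
  rw [map_add, map_sub, map_smul, coeff_elem, coeff_elem, if_neg hs.symm, if_neg hs'.symm,
    coeff_altSum_of_notMem_HVert hG he]
  simp

end IsPairElement

theorem exists_isPairChoice (hG : ∀ v, ¬ G.Adj v v) :
    ∃ base ω, IsPairChoice K G a b base ω := by
  classical
  have hbase : ∃ base : HComp G a b → V × V, ∀ k, (S G a b k).Nonempty → base k ∈ S G a b k :=
    ⟨fun k => if h : (S G a b k).Nonempty then h.some else (a, a), fun k h => by
      simp only [dif_pos h]
      exact h.some_mem⟩
  obtain ⟨base, hbase⟩ := hbase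
  have hend : ∀ k, ∀ s ∈ S G a b k, ∃ x ∈ k.supp, s.1 = x ∨ s.2 = x := by
    intro k s hs
    rcases ((mem_S_iff hG k s).1 hs).2 with ⟨⟨x, hx, hxs⟩, -⟩ | ⟨-, x, hx, hxs⟩
    · exact ⟨x, hx, .inl hxs.symm⟩
    · exact ⟨x, hx, .inr hxs.symm⟩
  have hω : ∀ k s, ∃ ω : Paths K V 3, s ∈ S G a b k → IsPairElement K G a b k (base k) s ω := by
    intro k s
    by_cases hs : s ∈ S G a b k
    · obtain ⟨x, hx, hxs⟩ := hend k _ (hbase k ⟨s, hs⟩)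
      obtain ⟨y, hy, hys⟩ := hend k s hs
      obtain ⟨p, hp⟩ := (SimpleGraph.ConnectedComponent.exact
        (hx.trans (Eq.symm hy))).exists_isPath
      exact ⟨_, fun _ => ⟨x, y, p, hx, hxs, hy, hys, hp, rfl⟩⟩
    · exact ⟨0, fun h => absurd h hs⟩
  choose ω hω using hω
  exact ⟨base, ω, hbase, fun k s hs _ => hω k s hs⟩

theorem exists_isSpanningForest : ∃ F, IsSpanningForest G a b F := by
  obtain ⟨F, hle, hac, hr⟩ := SimpleGraph.exists_isAcyclic_reachable_eq_le (G := HUndir G a b)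
  exact ⟨F, hle, hac, hr⟩

/-! ### The basis -/

section Basis

variable {F : SimpleGraph (HVert G a b)} {base : HComp G a b → V × V}
  {ω : HComp G a b → V × V → Paths K V 3}

theorem notMem_HVert_of_mem_freeEdges_union (hG : ∀ v, ¬ G.Adj v v) {base : HComp G a b → V × V}
    {e : V × V} (he : e ∈ edgesBetween G (freeTails G a b) (freeHeads G a b) ∪
      nonBaseEdges G a b base) : ¬ (e.1 ∈ HVert G a b ∧ e.2 ∈ HVert G a b) := by
  rcases he with he | ⟨k, hk, -⟩
  · exact fun h => ((mem_freeEdges_iff hG e).1 he).2.1 h.1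
  · exact notMem_HVert_of_mem_S hG hk

theorem mem_HVert_of_mem_chords {e : V × V} (he : e ∈ chords G a b F) :
    e.1 ∈ HVert G a b ∧ e.2 ∈ HVert G a b := by
  obtain ⟨x, y, -, -, rfl⟩ := he
  exact ⟨x.2, y.2⟩

variable (F base ω) in
/-- `η` is the element of `B₀ ∪ B₁ ∪ B₂` labelled by the pivot `e`. -/
def IsBasisElement (e : V × V) (η : Paths K V 3) : Prop :=
  IsCycleElement F e η ∨
    (e ∈ edgesBetween G (freeTails G a b) (freeHeads G a b) ∧ η = elem K a b e) ∨
      ∃ k, e ∈ S G a b k ∧ e ≠ base k ∧ η = ω k e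

theorem mem_basis_iff (η : Paths K V 3) :
    η ∈ B₀ K G a b F ∪ B₁ K G a b ∪ B₂ K G a b base ω ↔ ∃ e, IsBasisElement F base ω e η := by
  constructor
  · rintro ((⟨i, j, C, h1, h2, h3, h4, h5, h6⟩ | ⟨e, he, rfl⟩) | ⟨k, s, hs, hne, h⟩)
    · exact ⟨_, .inl ⟨i, j, C, h1, h2, h3, h4, h5, rfl, h6⟩⟩
    · exact ⟨e, .inr (.inl ⟨he, rfl⟩)⟩
    · exact ⟨s, .inr (.inr ⟨k, hs, hne, h⟩)⟩
  · rintro ⟨e, ⟨i, j, C, h1, h2, h3, h4, h5, -, h6⟩ | ⟨he, rfl⟩ | ⟨k, hs, hne, h⟩⟩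
    · exact .inl (.inl ⟨i, j, C, h1, h2, h3, h4, h5, h6⟩)
    · exact .inl (.inr ⟨e, he, rfl⟩)
    · exact .inr ⟨k, e, hs, hne, h⟩

namespace IsBasisElement

variable {e : V × V} {η : Paths K V 3}

theorem mem_pivots (h : IsBasisElement F base ω e η) : e ∈ pivots G a b F base := by
  rcases h with h | ⟨he, -⟩ | ⟨k, hs, hne, -⟩
  · exact .inr h.mem_chords
  · exact .inl (.inl he)
  · exact .inl (.inr ⟨k, hs, hne⟩)

theorem mem_OmegaCluster (hG : ∀ v, ¬ G.Adj v v) (hω : IsPairChoice K G a b base ω)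
    (h : IsBasisElement F base ω e η) : η ∈ OmegaCluster K G a b 3 := by
  rcases h with h | ⟨he, rfl⟩ | ⟨k, hs, hne, rfl⟩
  · exact h.mem_OmegaCluster hG
  · exact elem_mem_OmegaCluster hG he
  · exact (hω.pair k e hs hne).mem_OmegaCluster hG (hω.base_mem k ⟨e, hs⟩) hs

theorem coeff_self (hG : ∀ v, ¬ G.Adj v v) (hω : IsPairChoice K G a b base ω)
    (h : IsBasisElement F base ω e η) : coeff K a b e η ≠ 0 := by
  classical
  rcases h with h | ⟨he, rfl⟩ | ⟨k, hs, hne, rfl⟩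
  · rw [h.coeff_self hG]
    exact one_ne_zero
  · rw [coeff_elem, if_pos rfl]
    exact one_ne_zero
  · exact (hω.pair k e hs hne).coeff_self hG hs hne

theorem coeff_of_ne (hG : ∀ v, ¬ G.Adj v v) (hω : IsPairChoice K G a b base ω)
    (h : IsBasisElement F base ω e η) {e' : V × V}
    (he' : e' ∈ edgesBetween G (freeTails G a b) (freeHeads G a b) ∪ nonBaseEdges G a b base)
    (hne : e' ≠ e) : coeff K a b e' η = 0 := by
  classical
  have hH := notMem_HVert_of_mem_freeEdges_union hG he'
  rcases h with h | ⟨he, rfl⟩ | ⟨k, hs, hsne, rfl⟩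
  · exact h.coeff_of_notMem_HVert hG hH
  · rw [coeff_elem, if_neg hne.symm]
  · refine (hω.pair k e hs hsne).coeff_of_ne hG hH ?_ hne
    rintro rfl
    have hb := hω.base_mem k ⟨e, hs⟩
    rcases he' with he' | ⟨l, hl, hlne⟩
    · exact notMem_S_of_mem_freeEdges hG he' k hb
    · obtain rfl := eq_of_mem_S hG hb hl
      exact hlne rfl

theorem isCycleElement (hG : ∀ v, ¬ G.Adj v v) (h : IsBasisElement F base ω e η)
    (he : e ∈ chords G a b F) : IsCycleElement F e η := by
  have hH := mem_HVert_of_mem_chords he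
  rcases h with h | ⟨he, -⟩ | ⟨k, hs, -, -⟩
  · exact h
  · exact absurd hH.1 ((mem_freeEdges_iff hG e).1 he).2.1
  · exact absurd hH (notMem_HVert_of_mem_S hG hs)

theorem coeff_of_ne_of_mem_chords (hG : ∀ v, ¬ G.Adj v v) (h : IsBasisElement F base ω e η)
    (he : e ∈ chords G a b F) {e' : V × V} (he' : e' ∈ chords G a b F) (hne : e' ≠ e) :
    coeff K a b e' η = 0 :=
  (h.isCycleElement hG he).coeff_of_ne hG he' hne

/-- A pivot labels only one element, although the cycle in `B₀` is given by its properties: two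
cycle elements of `e` have the same coefficients at all pivots. -/
theorem unique [Finite V] (hG : ∀ v, ¬ G.Adj v v) (hF : IsSpanningForest G a b F)
    {η' : Paths K V 3} (h : IsBasisElement F base ω e η) (h' : IsBasisElement F base ω e η') :
    η = η' := by
  by_cases he : e ∈ chords G a b F
  · replace h := h.isCycleElement hG he
    replace h' := h'.isCycleElement hG he
    refine sub_eq_zero.1 (eq_zero_of_coeff_pivots hG hF base
      (sub_mem (h.mem_OmegaCluster hG) (h'.mem_OmegaCluster hG)) fun e' he' => ?_)
    rw [map_sub]
    by_cases hee' : e' = e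
    · rw [hee', h.coeff_self hG, h'.coeff_self hG, sub_self]
    · rcases he' with he' | he'
      · have hH := notMem_HVert_of_mem_freeEdges_union hG he'
        rw [h.coeff_of_notMem_HVert hG hH, h'.coeff_of_notMem_HVert hG hH, sub_self]
      · rw [h.coeff_of_ne hG he' hee', h'.coeff_of_ne hG he' hee', sub_self]
  · rcases h with h | ⟨h, rfl⟩ | ⟨k, hs, -, rfl⟩
    · exact absurd h.mem_chords he
    · rcases h' with h' | ⟨-, rfl⟩ | ⟨k, hs, -, -⟩
      · exact absurd h'.mem_chords he
      · rfl
      · exact absurd hs (notMem_S_of_mem_freeEdges hG h k)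
    · rcases h' with h' | ⟨h', -⟩ | ⟨l, hl, -, rfl⟩
      · exact absurd h'.mem_chords he
      · exact absurd hs (notMem_S_of_mem_freeEdges hG h' k)
      · rw [eq_of_mem_S hG hs hl]

end IsBasisElement

theorem exists_isBasisElement (hG : ∀ v, ¬ G.Adj v v) (hF : IsSpanningForest G a b F) {e : V × V}
    (he : e ∈ pivots G a b F base) : ∃ η, IsBasisElement F base ω e η := by
  rcases he with (he | ⟨k, hk, hne⟩) | he
  · exact ⟨_, .inr (.inl ⟨he, rfl⟩)⟩
  · exact ⟨_, .inr (.inr ⟨k, hk, hne, rfl⟩)⟩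
  · obtain ⟨η, hη⟩ := exists_isCycleElement (K := K) hG hF he
    exact ⟨η, .inl hη⟩

/-- The elements labelled by the pivots are linearly independent, being triangular with respect to
the coefficients at the pivots, and there are as many of them as the dimension of `OmegaCluster` can
be. -/
theorem basis_and_finrank [Finite V] (hG : ∀ v, ¬ G.Adj v v) (hF : IsSpanningForest G a b F)
    (hω : IsPairChoice K G a b base ω) :
    LinearIndepOn K id (B₀ K G a b F ∪ B₁ K G a b ∪ B₂ K G a b base ω) ∧
      Submodule.span K (B₀ K G a b F ∪ B₁ K G a b ∪ B₂ K G a b base ω) = OmegaCluster K G a b 3 ∧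
      Module.finrank K (OmegaCluster K G a b 3) = (pivots G a b F base).ncard := by
  classical
  have hex : ∀ e, ∃ η : Paths K V 3, e ∈ pivots G a b F base → IsBasisElement F base ω e η := by
    intro e
    by_cases he : e ∈ pivots G a b F base
    · obtain ⟨η, hη⟩ := exists_isBasisElement (ω := ω) hG hF he
      exact ⟨η, fun _ => hη⟩
    · exact ⟨0, fun h => absurd h he⟩
  choose w hw using hex
  have hB : B₀ K G a b F ∪ B₁ K G a b ∪ B₂ K G a b base ω = w '' pivots G a b F base := by
    ext η
    rw [mem_basis_iff]
    constructor
    · rintro ⟨e, he⟩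
      exact ⟨e, he.mem_pivots, (hw e he.mem_pivots).unique hG hF he⟩
    · rintro ⟨e, he, rfl⟩
      exact ⟨e, hw e he⟩
  have hli : LinearIndepOn K w (pivots G a b F base) := by
    refine linearIndepOn_union_of_triangular (coeff K a b) ?_ ?_ ?_ ?_
    · exact fun e he => (hw e (.inl he)).coeff_self hG hω
    · exact fun e he e' he' hne => (hw e' he').coeff_of_ne hG hω he hne.symm
    · exact fun e he => (hw e (.inr he)).coeff_self hG hω
    · exact fun e he e' he' hne =>
        (hw e' (.inr he')).coeff_of_ne_of_mem_chords hG he' he hne.symm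
  have hfin : Module.finrank K (Submodule.span K (w '' pivots G a b F base)) =
      (pivots G a b F base).ncard := by
    have := Fintype.ofFinite (w '' pivots G a b F base)
    rw [finrank_span_set_eq_card hli.id_image, ← Set.ncard_eq_toFinset_card',
      hli.injOn.ncard_image]
  have hle : Submodule.span K (w '' pivots G a b F base) ≤ OmegaCluster K G a b 3 := by
    rw [Submodule.span_le]
    rintro _ ⟨e, he, rfl⟩
    exact (hw e he).mem_OmegaCluster hG hω
  have hub : Module.finrank K (OmegaCluster K G a b 3) ≤ (pivots G a b F base).ncard := by
    have := Fintype.ofFinite (pivots G a b F base)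
    -- Reading off the coefficients at the pivots is injective on `OmegaCluster`.
    let T : OmegaCluster K G a b 3 →ₗ[K] (pivots G a b F base → K) :=
      LinearMap.pi fun e => coeff K a b e ∘ₗ (OmegaCluster K G a b 3).subtype
    have hT : Function.Injective T := by
      intro u u' huu'
      refine Subtype.ext (sub_eq_zero.1 (eq_zero_of_coeff_pivots hG hF base
        (sub_mem u.2 u'.2) fun e he => ?_))
      rw [map_sub]
      exact sub_eq_zero.2 (congrFun huu' ⟨e, he⟩)
    have := LinearMap.finrank_le_finrank_of_injective hT
    rwa [Module.finrank_fintype_fun_eq_card, ← Nat.card_eq_fintype_card] at this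
  have heq := Submodule.eq_of_le_of_finrank_le hle (hub.trans hfin.ge)
  rw [hB]
  exact ⟨hli.id_image, heq, heq ▸ hfin⟩

end Basis

/-! ### Counting the pivots -/

variable [Finite V] {F : SimpleGraph (HVert G a b)} {base : HComp G a b → V × V}

theorem ncard_chords_add (hG : ∀ v, ¬ G.Adj v v) (hF : IsSpanningForest G a b F) :
    (chords G a b F).ncard + (HVert G a b).ncard =
      (edges (H G a b)).ncard + Nat.card (HComp G a b) := by
  have hcomp : Nat.card (HComp G a b) = Nat.card F.ConnectedComponent := by
    unfold HComp SimpleGraph.ConnectedComponent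
    rw [hF.spanning]
  have hcount := hF.acyclic.ncard_edgeSet_add_card_connectedComponent
  let c : Set (HVert G a b × HVert G a b) := {p | (H G a b).Adj p.1 p.2 ∧ ¬ F.Adj p.1 p.2}
  let f : Set (HVert G a b × HVert G a b) := {p | (H G a b).Adj p.1 p.2 ∧ F.Adj p.1 p.2}
  have hc : (chords G a b F).ncard = c.ncard := by
    rw [← Set.ncard_image_of_injective c
      (Function.Injective.prodMap Subtype.val_injective Subtype.val_injective)]
    congr 1
    ext e
    constructor
    · rintro ⟨x, y, hxy, hF, rfl⟩
      exact ⟨(x, y), ⟨hxy, hF⟩, rfl⟩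
    · rintro ⟨⟨x, y⟩, ⟨hxy, hF⟩, rfl⟩
      exact ⟨x, y, hxy, hF, rfl⟩
  have hf : F.edgeSet.ncard = f.ncard := by
    have hinj : Set.InjOn (fun p : HVert G a b × HVert G a b => s(p.1, p.2)) f := by
      rintro ⟨x, y⟩ ⟨hxy, -⟩ ⟨x', y'⟩ ⟨hxy', -⟩ h
      rcases Sym2.eq_iff.1 h with ⟨h1, h2⟩ | ⟨h1, h2⟩
      · exact Prod.ext h1 h2
      · change x = y' at h1
        change y = x' at h2
        subst h1 h2
        exact absurd hxy' (H_asymm hG hxy)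
    rw [← hinj.ncard_image]
    congr 1
    ext e
    induction e with | _ x y
    constructor
    · intro h
      rcases (HUndir_adj_iff hG x y).1 (hF.le h) with h' | h'
      · exact ⟨(x, y), ⟨h', h⟩, rfl⟩
      · exact ⟨(y, x), ⟨h', SimpleGraph.Adj.symm h⟩, Sym2.eq_swap⟩
    · rintro ⟨p, ⟨-, hp⟩, h⟩
      rw [← h]
      exact hp
  have hunion : edges (H G a b) = c ∪ f := by
    ext p
    change (H G a b).Adj p.1 p.2 ↔ (_ ∧ _) ∨ (_ ∧ _)
    tauto
  have hdisj : Disjoint c f := Set.disjoint_left.2 fun p hc hf => hc.2 hf.2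
  rw [hunion, Set.ncard_union_eq hdisj, hc, hcomp, ← hf, ← Nat.card_coe_set_eq (HVert G a b)]
  omega

theorem ncard_nonBaseEdges (hG : ∀ v, ¬ G.Adj v v)
    (hbase : ∀ k, (S G a b k).Nonempty → base k ∈ S G a b k) :
    ((nonBaseEdges G a b base).ncard : ℤ) =
      ∑ᶠ k : HComp G a b, max 0 (((S G a b k).ncard : ℤ) - 1) := by
  have hunion : nonBaseEdges G a b base = ⋃ k, S G a b k \ {base k} := by
    ext e
    simp [nonBaseEdges]
  have hdisj : Pairwise (Function.onFun Disjoint fun k => S G a b k \ {base k}) :=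
    fun k l hkl => Set.disjoint_left.2 fun e hk hl => hkl (eq_of_mem_S hG hk.1 hl.1)
  have := Fintype.ofFinite (HComp G a b)
  rw [hunion, Set.ncard_iUnion_of_finite (fun k => Set.toFinite _) hdisj,
    finsum_eq_sum_of_fintype, finsum_eq_sum_of_fintype, Nat.cast_sum]
  refine Finset.sum_congr rfl fun k _ => ?_
  rcases (S G a b k).eq_empty_or_nonempty with h | h
  · simp [h]
  · have h1 := Set.ncard_sdiff_singleton_add_one (hbase k h)
    omega

theorem ncard_pivots (hG : ∀ v, ¬ G.Adj v v) (hF : IsSpanningForest G a b F)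
    (hbase : ∀ k, (S G a b k).Nonempty → base k ∈ S G a b k) :
    ((pivots G a b F base).ncard : ℤ) =
      ((edges (H G a b)).ncard - (HVert G a b).ncard + Nat.card (HComp G a b)) +
        (edgesBetween G (freeTails G a b) (freeHeads G a b)).ncard +
        ∑ᶠ k : HComp G a b, max 0 (((S G a b k).ncard : ℤ) - 1) := by
  have h1 : Disjoint (edgesBetween G (freeTails G a b) (freeHeads G a b))
      (nonBaseEdges G a b base) := by
    refine Set.disjoint_left.2 ?_
    rintro e he ⟨k, hk, -⟩
    exact notMem_S_of_mem_freeEdges hG he k hk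
  have h2 : Disjoint (edgesBetween G (freeTails G a b) (freeHeads G a b) ∪
      nonBaseEdges G a b base) (chords G a b F) := by
    exact Set.disjoint_left.2 fun e he hc =>
      notMem_HVert_of_mem_freeEdges_union hG he (mem_HVert_of_mem_chords hc)
  rw [pivots, Set.ncard_union_eq h2, Set.ncard_union_eq h1, ← ncard_nonBaseEdges hG hbase]
  have := ncard_chords_add hG hF
  omega

end PathHomology

end

theorem mainTheorem2 {V : Type*} [Finite V] (K : Type*) [Field K] (G : Digraph V)
    (hG : ∀ v, ¬ G.Adj v v) (a b : V) :
    -- the dimension formula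
    (Module.finrank K (PathHomology.OmegaCluster K G a b 3) : ℤ) =
        (((PathHomology.edges (PathHomology.H G a b)).ncard : ℤ)
            - ((PathHomology.HVert G a b).ncard : ℤ)
            + (Nat.card (PathHomology.HComp G a b) : ℤ))
          + ((PathHomology.edgesBetween G
                (PathHomology.outNbhd G a ∩ (PathHomology.inNbhd G b ∪ {b}))
                ((PathHomology.outNbhd G a ∪ {a}) ∩ PathHomology.inNbhd G b)).ncard : ℤ)
          + ∑ᶠ k : PathHomology.HComp G a b,
              max 0 (((PathHomology.S G a b k).ncard : ℤ) - 1) ∧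
    -- the choices from which the basis is built can be made
    (∃ F, PathHomology.IsSpanningForest G a b F) ∧
    (∃ base ω, PathHomology.IsPairChoice K G a b base ω) ∧
    -- every such choice gives a basis
    ∀ F base ω, PathHomology.IsSpanningForest G a b F →
      PathHomology.IsPairChoice K G a b base ω →
      LinearIndepOn K id
        (PathHomology.B₀ K G a b F ∪ PathHomology.B₁ K G a b ∪ PathHomology.B₂ K G a b base ω) ∧
      Submodule.span K
        (PathHomology.B₀ K G a b F ∪ PathHomology.B₁ K G a b ∪ PathHomology.B₂ K G a b base ω) =
          PathHomology.OmegaCluster K G a b 3 := by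
  obtain ⟨F, hF⟩ := PathHomology.exists_isSpanningForest (G := G) (a := a) (b := b)
  obtain ⟨base, ω, hω⟩ := PathHomology.exists_isPairChoice (K := K) (a := a) (b := b) hG
  refine ⟨?_, ⟨F, hF⟩, ⟨base, ω, hω⟩, fun F base ω hF hω => ?_⟩
  · rw [(PathHomology.basis_and_finrank hG hF hω).2.2]
    exact PathHomology.ncard_pivots hG hF hω.base_mem
  · have h := PathHomology.basis_and_finrank hG hF hω
    exact ⟨h.1, h.2.1⟩
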